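/- Let $m\ge 0$. Let $(\mathsf S,\prec)$ be an arborescent poset with a consistent anti-linearization, i.e. a poset with an injective order-reversing map $v:\mathsf S\hookrightarrow\{1,\dots,m\}$ (so $s\succ t$ implies $v(s)<v(t)$) such that for all $s,t,r\in\mathsf S$ with $v(s)<v(t)<v(r)$ and $s\succ r$ one has $t\succ r$. A composition $\bar d=(d_1,\dots,d_m)\in\mathbb Z_{\ge0}^m$ is called $\mathsf S$-dominant if $d_l=0$ for all $l\notin v(\mathsf S)$ and $d_{v(s)}\ge d_{v(t)}$ whenever $s\succ t$ in $\mathsf S$. Let $\lambda=(\lambda_1>\lambda_2>\dots>\lambda_m)$ be a regular (strictly decreasing) sequence of non-negative integers, and let $\mathbb S_m\lambda$ be the set of its rearrangements, equipped with the Bruhat order $\preceq_{\mathrm{Br}}$: the reflexive and transitive closure of the relations $\bar d\prec_{\mathrm{Br}}(ij)\bar d$, where $i<j$, $d_i>d_j$, and $(ij)\bar d$ is obtained from $\bar d$ by interchanging the entries in positions $i$ and $j$. Let $\mathsf D_{\mathsf S}=\mathsf D_{\mathsf S}^v(\lambda)\subset\mathbb S_m\lambda$ be the set of $\mathsf S$-dominant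 compositions with the induced partial order, let $\mu$ be the Möbius function of the poset $\mathsf D_{\mathsf S}$, and let $\mathrm{rk}(\bar d)$ be the maximal length of a chain in $\mathsf D_{\mathsf S}$ ending at $\bar d$. Then for all $\bar a,\bar b\in\mathsf D_{\mathsf S}$ $$\mu(\bar a,\bar b)=\begin{cases}(-1)^{\mathrm{rk}(\bar b)-\mathrm{rk}(\bar a)},&\text{if }\bar a\preceq_{\mathrm{Br}}\bar b\text{ and every }\bar c\in\mathbb S_m\lambda\text{ with }\bar a\prec_{\mathrm{Br}}\bar c\prec_{\mathrm{Br}}\bar b\text{ is }\mathsf S\text{-dominant},\\0,&\text{otherwise.}\end{cases}$$ -/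

import Mathlib

namespace BruhatDominant

/-- An arborescent poset `S` with consistent anti-linearization `v : S ↪ [1m]`: an injective
order-reversing map such that `v s < v t < v r` and `s ≻ r` imply `t ≻ r`
(equivalently, every principal filter of `S` is the preimage of an interval). -/
structure IsConsistentAntilinearization {m : ℕ} {S : Type*} [PartialOrder S]
    (v : S → Fin m) : Prop where
  injective : Function.Injective v
  strictAnti : StrictAnti v
  consistent : ∀ s t r : S, v s < v t → v t < v r → r < s → r < t

/-- The composition `d` is `S`-dominant: it vanishes outside the image of `v`, and its entries are
monotone along `S`. -/
structure IsDominant {m : ℕ} {S : Type*} [PartialOrder S]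
    (v : S → Fin m) (d : Fin m → ℕ) : Prop where
  eq_zero : ∀ l : Fin m, l ∉ Set.range v → d l = 0
  monotone : ∀ s t : S, t < s → d (v t) ≤ d (v s)

/-- An elementary ascent in Bruhat order on compositions: for positions `i < j` with `d i > d j`,
the two entries are interchanged. -/
def BruhatStep {m : ℕ} (d e : Fin m → ℕ) : Prop :=
  ∃ i j : Fin m, i < j ∧ d j < d i ∧ e = d ∘ Equiv.swap i j

/-- The (strong) Bruhat order on compositions, with the weakly decreasing arrangement as the
minimum of each orbit: the reflexive transitive closure of elementary ascents. -/
def BruhatLE {m : ℕ} : (Fin m → ℕ) → (Fin m → ℕ) → Prop :=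
  Relation.ReflTransGen BruhatStep

/-- A statistic that increases along elementary ascents. -/
def weight {m : ℕ} (d : Fin m → ℕ) : ℤ := ∑ i : Fin m, (i : ℤ) * (d i : ℤ)

theorem BruhatStep.weight_lt {m : ℕ} {d e : Fin m → ℕ} (h : BruhatStep d e) :
    weight d < weight e := by
  obtain ⟨i, j, hij, hd, rfl⟩ := h
  have hne : j ≠ i := hij.ne'
  have h1 : ((i : ℕ) : ℤ) < ((j : ℕ) : ℤ) := by exact_mod_cast hij
  have h2 : (d j : ℤ) < (d i : ℤ) := by exact_mod_cast hd
  have hj : j ∈ Finset.univ.erase i := by simp [hne]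
  unfold weight
  rw [← Finset.add_sum_erase _ _ (Finset.mem_univ i), ← Finset.add_sum_erase _ _ hj,
    ← Finset.add_sum_erase Finset.univ _ (Finset.mem_univ i), ← Finset.add_sum_erase _ _ hj]
  have hr : ∑ x ∈ (Finset.univ.erase i).erase j, ((x : ℕ) : ℤ) * ((d ∘ Equiv.swap i j) x : ℤ)
      = ∑ x ∈ (Finset.univ.erase i).erase j, ((x : ℕ) : ℤ) * (d x : ℤ) := by
    refine Finset.sum_congr rfl fun x hx => ?_
    simp only [Finset.mem_erase] at hx
    simp [Equiv.swap_apply_of_ne_of_ne hx.2.1 hx.1]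
  rw [hr]
  simp only [Function.comp_apply, Equiv.swap_apply_left, Equiv.swap_apply_right]
  nlinarith

theorem BruhatLE.eq_or_weight_lt {m : ℕ} {d e : Fin m → ℕ} (h : BruhatLE d e) :
    d = e ∨ weight d < weight e := by
  induction h with
  | refl => exact Or.inl rfl
  | tail _ hs ih =>
    rcases ih with rfl | ih
    · exact Or.inr hs.weight_lt
    · exact Or.inr (ih.trans hs.weight_lt)

/-- The orbit of the composition `lam` under permutation of positions. -/
@[ext]
structure Orbit {m : ℕ} (lam : Fin m → ℕ) where
  val : Fin m → ℕ
  exists_perm : ∃ σ : Equiv.Perm (Fin m), val = lam ∘ σ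

/-- The orbit, partially ordered by Bruhat order. -/
instance {m : ℕ} (lam : Fin m → ℕ) : PartialOrder (Orbit lam) where
  le d e := BruhatLE d.val e.val
  le_refl _ := Relation.ReflTransGen.refl
  le_trans _ _ _ h h' := Relation.ReflTransGen.trans h h'
  le_antisymm d e h h' := by
    rcases BruhatLE.eq_or_weight_lt h with h1 | h1
    · exact Orbit.ext h1
    · rcases BruhatLE.eq_or_weight_lt h' with h2 | h2
      · exact Orbit.ext h2.symm
      · exact absurd (h1.trans h2) (lt_irrefl _)

instance {m : ℕ} (lam : Fin m → ℕ) : Finite (Orbit lam) :=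
  Finite.of_surjective (fun σ : Equiv.Perm (Fin m) => (⟨lam ∘ σ, σ, rfl⟩ : Orbit lam))
    (fun d => ⟨d.exists_perm.choose, Orbit.ext d.exists_perm.choose_spec.symm⟩)

/-- The set of `S`-dominant compositions in the orbit of `lam`, with the induced Bruhat order. -/
abbrev DominantPoset {m : ℕ} {S : Type*} [PartialOrder S] (v : S → Fin m) (lam : Fin m → ℕ) :
    Type :=
  {d : Orbit lam // IsDominant v d.val}

open Classical in
/-- The Möbius function of a finite poset. -/
noncomputable def mobius {X : Type*} [PartialOrder X] [Finite X] (x y : X) : ℤ :=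
  letI : Fintype X := Fintype.ofFinite X
  letI : LocallyFiniteOrder X := Fintype.toLocallyFiniteOrder
  IncidenceAlgebra.mu ℤ x y

/-- The rank of an element of a finite poset: the length of a longest chain ending at it (in a
bounded graded poset, the length of any maximal chain from the least element to it). -/
noncomputable def rk {X : Type*} [PartialOrder X] [Finite X] (x : X) : ℕ :=
  (Order.height x).toNat

end BruhatDominant

/-!
The dominant compositions form an order ideal of the left weak order on the orbit which is moreover
cut out by inequalities between positions satisfying a strong convexity condition (each principal
filter of `S` occupies an interval of the image of `v`). In Coxeter-theoretic terms they are a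
generalized quotient of the symmetric group, and the formula is that of Björner and Wachs for
such quotients. The proof here avoids shellability and follows Verma's computation of the Möbius
function of Bruhat order.

Call an interval full if it consists of dominant compositions. The claimed formula amounts to
`∑ (-1) ^ rk c = 0` for dominant `a < b`, the sum being over all `c` in `[a, b]` such that `[c, b]`
is full (`Orbit.sum_rankSign_eq_zero`). Choose an interchange `s` of two adjacent values that
descends at `b` (`Orbit.exists_isAdmissible_swapVal_lt`). The lifting property of Bruhat order
shows that `s` changes the rank among dominant compositions by one
(`Orbit.rk_eq_rk_swapVal_add_one`), so no separate length function is needed.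

* If `s` ascends at `a`, it is a sign-reversing involution on the summands.
* If `s` descends at `a`, the sum for `(s a, b)` vanishes by the first case, and what it has in
  excess of the sum for `(a, b)` is a sum over `c ≥ s a` with `¬ a ≤ c`. For such `c` the intervals
  `[c, b]` and `[c, s b]` are full simultaneously (`Orbit.mem_fullBelow_swapVal_iff`), so the excess
  is the sum for `(s a, s b)` minus that for `(a, s b)`, and both vanish by induction on `b`.

The equivalence of fullness is where the shape of `S` enters. It rests on two facts.
`Orbit.isDominant_swapVal_of_interval`: along a full interval, `s` cannot start leading out of the
dominant compositions. `Orbit.swapVal_le_of_not_isDominant`: if `s` leads out of the dominant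
compositions at `c ≥ s a` but not at `s a`, then already `a ≤ c`. The lifting property and the
second fact are read off from the tableau criterion `Orbit.le_iff_prefixCount`.
-/

namespace BruhatDominant

/-! ### The tableau criterion for Bruhat order -/

/-- The number of entries of `d` among the first `p` positions that are at least `q`. Bruhat
order is the reverse pointwise order of these counts (the tableau criterion). -/
def prefixCount {m : ℕ} (d : Fin m → ℕ) (p q : ℕ) : ℕ :=
  (Finset.univ.filter fun i : Fin m => (i : ℕ) < p ∧ q ≤ d i).card

theorem prefixCount_swap {m : ℕ} (d : Fin m → ℕ) {i j : Fin m} (hij : i < j) (hd : d j < d i)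
    (p q : ℕ) :
    prefixCount (d ∘ Equiv.swap i j) p q
        + (if (i : ℕ) < p ∧ p ≤ (j : ℕ) ∧ d j < q ∧ q ≤ d i then 1 else 0)
      = prefixCount d p q := by
  have hj : j ∈ Finset.univ.erase i := by simp [hij.ne']
  have h1 : (i : ℕ) < (j : ℕ) := hij
  unfold prefixCount
  rw [Finset.card_filter, Finset.card_filter, ← Finset.add_sum_erase _ _ (Finset.mem_univ i),
    ← Finset.add_sum_erase _ _ hj, ← Finset.add_sum_erase Finset.univ _ (Finset.mem_univ i),
    ← Finset.add_sum_erase _ _ hj]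
  have hr : ∑ x ∈ (Finset.univ.erase i).erase j,
        (if (x : ℕ) < p ∧ q ≤ (d ∘ Equiv.swap i j) x then 1 else 0)
      = ∑ x ∈ (Finset.univ.erase i).erase j, (if (x : ℕ) < p ∧ q ≤ d x then 1 else 0) := by
    refine Finset.sum_congr rfl fun x hx => ?_
    simp only [Finset.mem_erase] at hx
    simp [Equiv.swap_apply_of_ne_of_ne hx.2.1 hx.1]
  rw [hr]
  simp only [Function.comp_apply, Equiv.swap_apply_left, Equiv.swap_apply_right]
  split_ifs <;> omega

theorem BruhatLE.prefixCount_le {m : ℕ} {d e : Fin m → ℕ} (h : BruhatLE d e) (p q : ℕ) :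
    prefixCount e p q ≤ prefixCount d p q := by
  induction h with
  | refl => exact le_rfl
  | tail _ hs ih =>
    obtain ⟨i, j, hij, hd, rfl⟩ := hs
    have := prefixCount_swap _ hij hd p q
    omega

theorem prefixCount_eq_add {m : ℕ} (d : Fin m → ℕ) (p : ℕ) {q r : ℕ} (hqr : q ≤ r) :
    prefixCount d p q = prefixCount d p r
      + (Finset.univ.filter fun i : Fin m => (i : ℕ) < p ∧ q ≤ d i ∧ d i < r).card := by
  unfold prefixCount
  rw [← Finset.card_union_of_disjoint]
  · congr 1
    ext i
    simp only [Finset.mem_filter, Finset.mem_univ, true_and, Finset.mem_union]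
    omega
  · rw [Finset.disjoint_filter]
    intros
    omega

theorem prefixCount_eq_add_of_le {m : ℕ} (d : Fin m → ℕ) (q : ℕ) {p r : ℕ} (hpr : p ≤ r) :
    prefixCount d r q = prefixCount d p q
      + (Finset.univ.filter fun i : Fin m => p ≤ (i : ℕ) ∧ (i : ℕ) < r ∧ q ≤ d i).card := by
  unfold prefixCount
  rw [← Finset.card_union_of_disjoint]
  · congr 1
    ext i
    simp only [Finset.mem_filter, Finset.mem_univ, true_and, Finset.mem_union]
    omega
  · rw [Finset.disjoint_filter]
    intros
    omega

theorem prefixCount_succ {m : ℕ} (d : Fin m → ℕ) (l : Fin m) (q : ℕ) :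
    prefixCount d (l + 1) q = prefixCount d l q + if q ≤ d l then 1 else 0 := by
  unfold prefixCount
  have : (Finset.univ.filter fun i : Fin m => (i : ℕ) < l + 1 ∧ q ≤ d i)
      = (Finset.univ.filter fun i : Fin m => (i : ℕ) < l ∧ q ≤ d i)
        ∪ (if q ≤ d l then {l} else ∅) := by
    ext i
    have : i = l ↔ (i : ℕ) = l := Fin.ext_iff
    split_ifs with h
    · simp only [Finset.mem_filter, Finset.mem_univ, true_and, Finset.mem_union,
        Finset.mem_singleton]
      by_cases hil : i = l
      · subst hil; simp [h]
      · simp only [hil, or_false]; omega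
    · simp only [Finset.mem_filter, Finset.mem_univ, true_and, Finset.mem_union,
        Finset.notMem_empty, or_false]
      by_cases hil : i = l
      · subst hil; simp [h]
      · omega
  rw [this, Finset.card_union_of_disjoint]
  · split_ifs <;> simp
  · split_ifs <;> simp

theorem prefixCount_congr {m : ℕ} {d e : Fin m → ℕ} {p : ℕ}
    (h : ∀ i : Fin m, (i : ℕ) < p → d i = e i) (q : ℕ) :
    prefixCount d p q = prefixCount e p q := by
  unfold prefixCount
  congr 1
  refine Finset.filter_congr fun i _ => and_congr_right fun hi => ?_
  rw [h i hi]

namespace Orbit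

variable {m : ℕ} {lam : Fin m → ℕ}

theorem val_injective (hlam : StrictAnti lam) (d : Orbit lam) : Function.Injective d.val := by
  obtain ⟨σ, h⟩ := d.exists_perm
  rw [h]
  exact hlam.injective.comp σ.injective

theorem exists_val_eq (d : Orbit lam) (x : Fin m) : ∃ i, d.val i = lam x := by
  obtain ⟨σ, h⟩ := d.exists_perm
  exact ⟨σ.symm x, by simp [h]⟩

theorem exists_eq_lam (d : Orbit lam) (i : Fin m) : ∃ x, d.val i = lam x := by
  obtain ⟨σ, h⟩ := d.exists_perm
  exact ⟨σ i, by simp [h]⟩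

/-- Interchange of the entries in two positions. -/
def swapPos (d : Orbit lam) (i j : Fin m) : Orbit lam where
  val := d.val ∘ Equiv.swap i j
  exists_perm := by
    obtain ⟨σ, h⟩ := d.exists_perm
    exact ⟨(Equiv.swap i j).trans σ, by rw [h]; rfl⟩

@[simp] theorem swapPos_val (d : Orbit lam) (i j : Fin m) :
    (d.swapPos i j).val = d.val ∘ Equiv.swap i j := rfl

theorem lt_swapPos (d : Orbit lam) {i j : Fin m} (hij : i < j) (h : d.val j < d.val i) :
    d < d.swapPos i j := by
  have hs : BruhatStep d.val (d.swapPos i j).val := ⟨i, j, hij, h, rfl⟩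
  refine lt_of_le_of_ne (Relation.ReflTransGen.single hs) fun he => ?_
  have := hs.weight_lt
  rw [← he] at this
  exact lt_irrefl _ this

/-- The tableau criterion for Bruhat order. -/
theorem le_iff_prefixCount (hlam : StrictAnti lam) {d e : Orbit lam} :
    d ≤ e ↔ ∀ p q, prefixCount e.val p q ≤ prefixCount d.val p q := by
  refine ⟨fun h => BruhatLE.prefixCount_le h, ?_⟩
  induction d using WellFoundedGT.induction with
  | ind d ih =>
  intro h
  by_cases hde : d = e
  · exact hde.le
  -- Swap the first entry `d p` that exceeds `e p` with the next later entry in `[e p, d p)`: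
  -- the resulting composition still lies below `e`.
  have hne : {i : Fin m | d.val i ≠ e.val i}.Nonempty := by
    by_contra hcon
    rw [Set.not_nonempty_iff_eq_empty, Set.eq_empty_iff_forall_notMem] at hcon
    exact hde (Orbit.ext (funext fun i => by simpa using hcon i))
  obtain ⟨p, hp, hpmin⟩ := (wellFounded_lt (α := Fin m)).has_min _ hne
  have hbefore : ∀ i : Fin m, (i : ℕ) < p → d.val i = e.val i := fun i hi => by
    by_contra hcon
    exact hpmin i hcon hi
  have hlt : e.val p < d.val p := by
    have h1 := h (p + 1) (e.val p)
    rw [prefixCount_succ, prefixCount_succ, prefixCount_congr hbefore, if_pos le_rfl] at h1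
    refine lt_of_le_of_ne ?_ (Ne.symm hp)
    by_contra hcon
    rw [if_neg hcon] at h1
    omega
  have hne' : {j : Fin m | p < j ∧ e.val p ≤ d.val j ∧ d.val j < d.val p}.Nonempty := by
    obtain ⟨x, hx⟩ := e.exists_eq_lam p
    obtain ⟨j, hj⟩ := d.exists_val_eq x
    have hje : d.val j = e.val p := by rw [hj, hx]
    refine ⟨j, ?_, hje.ge, hje.trans_lt hlt⟩
    rcases lt_trichotomy j p with hjp | rfl | hjp
    · have := e.val_injective hlam ((hbefore j hjp).symm.trans hje)
      exact absurd this hjp.ne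
    · exact absurd hje hlt.ne'
    · exact hjp
  obtain ⟨j, ⟨hpj, hj1, hj2⟩, hjmin⟩ := (wellFounded_lt (α := Fin m)).has_min _ hne'
  have hstep := d.lt_swapPos hpj hj2
  refine hstep.le.trans (ih _ hstep fun r q => ?_)
  have hcount := prefixCount_swap d.val hpj hj2 r q
  have hrq := h r q
  rw [swapPos_val]
  split_ifs at hcount with hc
  swap
  · omega
  obtain ⟨hc1, hc2, hc3, hc4⟩ := hc
  have h1 := h r (e.val p)
  rw [prefixCount_eq_add d.val r (hj1.trans hc3.le),
    prefixCount_eq_add e.val r (hj1.trans hc3.le)] at h1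
  have h2 : (Finset.univ.filter fun i : Fin m => (i : ℕ) < r ∧ e.val p ≤ d.val i ∧ d.val i < q).card
      < (Finset.univ.filter
          fun i : Fin m => (i : ℕ) < r ∧ e.val p ≤ e.val i ∧ e.val i < q).card := by
    refine Finset.card_lt_card (Finset.ssubset_iff_of_subset ?_ |>.2 ⟨p, ?_, ?_⟩)
    · intro i
      simp only [Finset.mem_filter, Finset.mem_univ, true_and]
      rintro ⟨hir, hi1, hi2⟩
      have hip : (i : ℕ) < p := by
        rcases lt_trichotomy i p with hip | rfl | hip
        · exact hip
        · omega
        · exact absurd (Fin.lt_def.2 (hir.trans_le hc2)) (hjmin i ⟨hip, hi1, hi2.trans_le hc4⟩)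
      rw [← hbefore i hip]
      exact ⟨hir, hi1, hi2⟩
    · simp only [Finset.mem_filter, Finset.mem_univ, true_and]
      omega
    · simp only [Finset.mem_filter, Finset.mem_univ, true_and]
      omega
  omega

/-! ### Interchange of adjacent values and the lifting property -/

/-- The position at which `d` takes the value `lam x`. -/
noncomputable def pos (d : Orbit lam) (x : Fin m) : Fin m := (d.exists_val_eq x).choose

@[simp] theorem val_pos (d : Orbit lam) (x : Fin m) : d.val (d.pos x) = lam x :=
  (d.exists_val_eq x).choose_spec

theorem pos_eq (hlam : StrictAnti lam) {d : Orbit lam} {x i : Fin m} (h : d.val i = lam x) :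
    d.pos x = i :=
  d.val_injective hlam (by rw [val_pos, h])

/-- Interchange of the values `lam x` and `lam y`: for adjacent values this is the left
multiplication by a simple transposition. -/
noncomputable def swapVal (d : Orbit lam) (x y : Fin m) : Orbit lam :=
  d.swapPos (d.pos x) (d.pos y)

theorem swapVal_val (d : Orbit lam) (x y : Fin m) :
    (d.swapVal x y).val = d.val ∘ Equiv.swap (d.pos x) (d.pos y) := rfl

theorem swapVal_val_pos_left (d : Orbit lam) (x y : Fin m) :
    (d.swapVal x y).val (d.pos x) = lam y := by
  simp [swapVal]

theorem swapVal_val_pos_right (d : Orbit lam) (x y : Fin m) :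
    (d.swapVal x y).val (d.pos y) = lam x := by
  simp [swapVal]

theorem swapVal_val_of_ne (d : Orbit lam) {x y i : Fin m} (hx : i ≠ d.pos x) (hy : i ≠ d.pos y) :
    (d.swapVal x y).val i = d.val i := by
  simp [swapVal, Equiv.swap_apply_of_ne_of_ne hx hy]

theorem pos_swapVal_left (hlam : StrictAnti lam) (d : Orbit lam) (x y : Fin m) :
    (d.swapVal x y).pos x = d.pos y :=
  pos_eq hlam (d.swapVal_val_pos_right x y)

theorem pos_swapVal_right (hlam : StrictAnti lam) (d : Orbit lam) (x y : Fin m) :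
    (d.swapVal x y).pos y = d.pos x :=
  pos_eq hlam (d.swapVal_val_pos_left x y)

theorem swapVal_swapVal (hlam : StrictAnti lam) (d : Orbit lam) (x y : Fin m) :
    (d.swapVal x y).swapVal x y = d := by
  refine Orbit.ext ?_
  rw [swapVal_val, pos_swapVal_left hlam, pos_swapVal_right hlam, swapVal_val]
  funext i
  simp [Equiv.swap_comm (d.pos y)]

/-- The values `lam x > lam y` are adjacent: the orbit has no value between them. -/
structure IsAdjacent (lam : Fin m → ℕ) (x y : Fin m) : Prop where
  lt : lam y < lam x
  le_or_le : ∀ k, lam k ≤ lam y ∨ lam x ≤ lam k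

variable {x y : Fin m}

theorem IsAdjacent.val_le_or_le (hxy : IsAdjacent lam x y) (d : Orbit lam) (i : Fin m) :
    d.val i ≤ lam y ∨ lam x ≤ d.val i := by
  obtain ⟨k, hk⟩ := d.exists_eq_lam i
  rw [hk]
  exact hxy.le_or_le k

theorem IsAdjacent.pos_ne (hxy : IsAdjacent lam x y) (d : Orbit lam) : d.pos x ≠ d.pos y :=
  fun h => hxy.lt.ne' (by rw [← d.val_pos x, h, val_pos])

theorem lt_swapVal (hxy : IsAdjacent lam x y) {d : Orbit lam} (h : d.pos x < d.pos y) :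
    d < d.swapVal x y :=
  d.lt_swapPos h (by simpa using hxy.lt)

theorem swapVal_lt (hlam : StrictAnti lam) (hxy : IsAdjacent lam x y) {d : Orbit lam}
    (h : d.pos y < d.pos x) : d.swapVal x y < d := by
  have := lt_swapVal hxy (d := d.swapVal x y)
    (by rwa [pos_swapVal_left hlam, pos_swapVal_right hlam])
  rwa [swapVal_swapVal hlam] at this

theorem pos_lt_of_lt_swapVal (hlam : StrictAnti lam) (hxy : IsAdjacent lam x y) {d : Orbit lam}
    (h : d < d.swapVal x y) : d.pos x < d.pos y := by
  rcases lt_or_gt_of_ne (hxy.pos_ne d) with h1 | h1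
  · exact h1
  · exact absurd (h.trans (swapVal_lt hlam hxy h1)) (lt_irrefl _)

theorem pos_lt_of_swapVal_lt (hlam : StrictAnti lam) (hxy : IsAdjacent lam x y) {d : Orbit lam}
    (h : d.swapVal x y < d) : d.pos y < d.pos x := by
  have := pos_lt_of_lt_swapVal hlam hxy (d := d.swapVal x y) (by rwa [swapVal_swapVal hlam])
  rwa [pos_swapVal_left hlam, pos_swapVal_right hlam] at this

theorem lt_swapVal_or_swapVal_lt (hlam : StrictAnti lam) (hxy : IsAdjacent lam x y)
    (d : Orbit lam) : d < d.swapVal x y ∨ d.swapVal x y < d :=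
  (lt_or_gt_of_ne (hxy.pos_ne d)).imp (lt_swapVal hxy) (swapVal_lt hlam hxy)

theorem prefixCount_swapVal (hxy : IsAdjacent lam x y) {d : Orbit lam} (h : d.pos x < d.pos y)
    (p q : ℕ) :
    prefixCount (d.swapVal x y).val p q
        + (if (d.pos x : ℕ) < p ∧ p ≤ (d.pos y : ℕ) ∧ lam y < q ∧ q ≤ lam x then 1 else 0)
      = prefixCount d.val p q := by
  have := prefixCount_swap d.val h (by simpa using hxy.lt) p q
  simpa only [val_pos, swapVal_val] using this

/-- For a threshold in `(lam y, lam x]` the prefix count falls short of that for `lam y` only by the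
entry `lam y` itself. -/
theorem prefixCount_lower (hlam : StrictAnti lam) (hxy : IsAdjacent lam x y) (d : Orbit lam)
    (p : ℕ) {q : ℕ} (hq : lam y < q) (hq' : q ≤ lam x) :
    prefixCount d.val p (lam y) = prefixCount d.val p q + if (d.pos y : ℕ) < p then 1 else 0 := by
  rw [prefixCount_eq_add d.val p hq.le]
  congr 1
  have key : ∀ i : Fin m, ((i : ℕ) < p ∧ lam y ≤ d.val i ∧ d.val i < q)
      ↔ i = d.pos y ∧ (d.pos y : ℕ) < p := by
    intro i
    constructor
    · rintro ⟨h1, h2, h3⟩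
      have : d.pos y = i := by
        refine pos_eq hlam ?_
        rcases hxy.val_le_or_le d i with h | h <;> omega
      exact ⟨this.symm, by rwa [this]⟩
    · rintro ⟨rfl, h⟩
      exact ⟨h, by rw [val_pos], by rwa [val_pos]⟩
  simp only [key]
  split_ifs with h <;> simp [h, Finset.filter_eq']

/-- For a threshold in `(lam y, lam x]` the prefix count exceeds that for `lam x + 1` only by the
entry `lam x` itself. -/
theorem prefixCount_upper (hlam : StrictAnti lam) (hxy : IsAdjacent lam x y) (d : Orbit lam)
    (p : ℕ) {q : ℕ} (hq : lam y < q) (hq' : q ≤ lam x) :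
    prefixCount d.val p q
      = prefixCount d.val p (lam x + 1) + if (d.pos x : ℕ) < p then 1 else 0 := by
  rw [prefixCount_eq_add d.val p (hq'.trans (Nat.le_succ _))]
  congr 1
  have key : ∀ i : Fin m, ((i : ℕ) < p ∧ q ≤ d.val i ∧ d.val i < lam x + 1)
      ↔ i = d.pos x ∧ (d.pos x : ℕ) < p := by
    intro i
    constructor
    · rintro ⟨h1, h2, h3⟩
      have : d.pos x = i := by
        refine pos_eq hlam ?_
        rcases hxy.val_le_or_le d i with h | h <;> omega
      exact ⟨this.symm, by rwa [this]⟩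
    · rintro ⟨rfl, h⟩
      exact ⟨h, by rwa [val_pos], by rw [val_pos]; exact Nat.lt_succ_self _⟩
  simp only [key]
  split_ifs with h <;> simp [h, Finset.filter_eq']

/-- The lifting property of Bruhat order: what ascends at `d` and descends at `e ≥ d` carries `d`
to an element that is still below `e`. -/
theorem swapVal_le_of_le (hlam : StrictAnti lam) (hxy : IsAdjacent lam x y) {d e : Orbit lam}
    (hde : d ≤ e) (hd : d < d.swapVal x y) (he : e.swapVal x y < e) : d.swapVal x y ≤ e := by
  have hd' := pos_lt_of_lt_swapVal hlam hxy hd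
  have he' := pos_lt_of_swapVal_lt hlam hxy he
  rw [le_iff_prefixCount hlam] at hde ⊢
  intro p q
  have h := prefixCount_swapVal hxy hd' p q
  have h1 := hde p q
  split_ifs at h with hc
  · have h2 := hde p (lam y)
    have h3 := hde p (lam x + 1)
    have d1 := prefixCount_lower hlam hxy d p hc.2.2.1 hc.2.2.2
    have d2 := prefixCount_upper hlam hxy d p hc.2.2.1 hc.2.2.2
    have e1 := prefixCount_lower hlam hxy e p hc.2.2.1 hc.2.2.2
    have e2 := prefixCount_upper hlam hxy e p hc.2.2.1 hc.2.2.2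
    rw [Fin.lt_def] at hd' he'
    split_ifs at d1 d2 e1 e2 <;> omega
  · omega

/-- The lifting property of Bruhat order: what ascends at `d` and descends at `e ≥ d` carries `e`
to an element that is still above `d`. -/
theorem le_swapVal_of_le (hlam : StrictAnti lam) (hxy : IsAdjacent lam x y) {d e : Orbit lam}
    (hde : d ≤ e) (hd : d < d.swapVal x y) (he : e.swapVal x y < e) : d ≤ e.swapVal x y := by
  have hd' := pos_lt_of_lt_swapVal hlam hxy hd
  have he' := pos_lt_of_swapVal_lt hlam hxy he
  rw [le_iff_prefixCount hlam] at hde ⊢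
  intro p q
  have h := prefixCount_swapVal hxy (d := e.swapVal x y)
    (by rwa [pos_swapVal_left hlam, pos_swapVal_right hlam]) p q
  rw [swapVal_swapVal hlam, pos_swapVal_left hlam, pos_swapVal_right hlam] at h
  have h1 := hde p q
  split_ifs at h with hc
  · have h2 := hde p (lam y)
    have h3 := hde p (lam x + 1)
    have d1 := prefixCount_lower hlam hxy d p hc.2.2.1 hc.2.2.2
    have d2 := prefixCount_upper hlam hxy d p hc.2.2.1 hc.2.2.2
    have e1 := prefixCount_lower hlam hxy e p hc.2.2.1 hc.2.2.2
    have e2 := prefixCount_upper hlam hxy e p hc.2.2.1 hc.2.2.2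
    rw [Fin.lt_def] at hd' he'
    split_ifs at d1 d2 e1 e2 <;> omega
  · omega

theorem swapVal_mono_of_swapVal_lt (hlam : StrictAnti lam) (hxy : IsAdjacent lam x y)
    {d e : Orbit lam} (hde : d ≤ e) (hd : d.swapVal x y < d) (he : e.swapVal x y < e) :
    d.swapVal x y ≤ e.swapVal x y :=
  le_swapVal_of_le hlam hxy (hd.le.trans hde) (by rwa [swapVal_swapVal hlam]) he

variable {S : Type*} [PartialOrder S] {v : S → Fin m}

/-! ### Dominance and interchanges of adjacent values -/

/-- Adjacent values whose interchange preserves the vanishing of compositions outside the image of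
`v`: unless `v` is surjective, the value zero is pinned and may not be moved. -/
structure IsAdmissible (v : S → Fin m) (lam : Fin m → ℕ) (x y : Fin m) : Prop
    extends IsAdjacent lam x y where
  pos_of_notMem_range : ∀ l, l ∉ Set.range v → 0 < lam y

theorem mem_range_of_pos {d : Orbit lam} (hd : IsDominant v d.val) {l : Fin m}
    (h : 0 < d.val l) : l ∈ Set.range v := by
  by_contra hcon
  exact h.ne' (hd.eq_zero l hcon)

theorem IsAdmissible.mem_range (hxy : IsAdmissible v lam x y) {d : Orbit lam}
    (hd : IsDominant v d.val) {l : Fin m} (h : lam y ≤ d.val l) : l ∈ Set.range v := by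
  by_contra hcon
  have h1 := hxy.pos_of_notMem_range l hcon
  have h2 := hd.eq_zero l hcon
  omega

/-- The interchange of admissible values leaves the set of dominant compositions only if it
occurs at two positions labelled by comparable elements. -/
theorem exists_lt_of_not_isDominant (hlam : StrictAnti lam) (hxy : IsAdmissible v lam x y)
    {d : Orbit lam} (hd : IsDominant v d.val) (hn : ¬ IsDominant v (d.swapVal x y).val) :
    ∃ s t, t < s ∧ v s = d.pos x ∧ v t = d.pos y := by
  by_contra hcon
  push Not at hcon
  have hlt := hxy.lt
  refine hn ⟨fun l hl => ?_, fun s t hts => ?_⟩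
  · have h0 := hd.eq_zero l hl
    have h1 := hxy.pos_of_notMem_range l hl
    rw [swapVal_val_of_ne, h0]
    · rintro rfl
      rw [val_pos] at h0
      omega
    · rintro rfl
      rw [val_pos] at h0
      omega
  · have h1 := hd.monotone s t hts
    have h2 := hcon s t hts
    have inj : ∀ {i z}, i ≠ d.pos z → d.val i ≠ lam z := fun hi he => hi (pos_eq hlam he).symm
    have adjs := hxy.val_le_or_le d (v s)
    have adjt := hxy.val_le_or_le d (v t)
    by_cases hsx : v s = d.pos x
    · have hty := h2 hsx
      rw [hsx, swapVal_val_pos_left]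
      rw [hsx, val_pos] at h1
      by_cases htx : v t = d.pos x
      · rw [htx, swapVal_val_pos_left]
      · rw [swapVal_val_of_ne d htx hty]
        have := inj htx
        omega
    · by_cases hsy : v s = d.pos y
      · rw [hsy, swapVal_val_pos_right]
        rw [hsy, val_pos] at h1
        by_cases htx : v t = d.pos x
        · rw [htx, val_pos] at h1
          omega
        · by_cases hty : v t = d.pos y
          · rw [hty, swapVal_val_pos_right]
          · rw [swapVal_val_of_ne d htx hty]
            omega
      · rw [swapVal_val_of_ne d hsx hsy]
        have := inj hsy
        by_cases htx : v t = d.pos x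
        · rw [htx, swapVal_val_pos_left]
          rw [htx, val_pos] at h1
          omega
        · by_cases hty : v t = d.pos y
          · rw [hty, swapVal_val_pos_right]
            rw [hty, val_pos] at h1
            omega
          · rwa [swapVal_val_of_ne d htx hty]

/-- Dominant compositions are closed under descending interchanges of admissible values: they form
an order ideal of the left weak order. -/
theorem isDominant_swapVal_of_lt (hv : IsConsistentAntilinearization v) (hlam : StrictAnti lam)
    (hxy : IsAdmissible v lam x y) {d : Orbit lam} (hd : IsDominant v d.val)
    (h : d.swapVal x y < d) : IsDominant v (d.swapVal x y).val := by
  by_contra hn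
  obtain ⟨s, t, hts, hs, ht⟩ := exists_lt_of_not_isDominant hlam hxy hd hn
  have h1 := hv.strictAnti hts
  rw [hs, ht] at h1
  exact lt_asymm h1 (pos_lt_of_swapVal_lt hlam hxy.toIsAdjacent h)

theorem exists_step_of_lt {a z : Orbit lam} (h : a < z) :
    ∃ c : Orbit lam, ∃ k l, a ≤ c ∧ k < l ∧ c.val l < c.val k ∧ z = c.swapPos k l := by
  rcases Relation.ReflTransGen.cases_tail h.le with h1 | ⟨c, hac, k, l, hkl, hc, hz⟩
  · exact absurd (Orbit.ext h1.symm) h.ne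
  · have : c = (z.swapPos k l).val := by
      funext i
      simp [hz]
    subst this
    exact ⟨z.swapPos k l, k, l, hac, hkl, hc, Orbit.ext hz⟩

/-- If the bottom of an interval of dominant compositions admits an ascending interchange within
the dominant compositions, then so does every element of the interval at which the interchange
ascends. -/
theorem isDominant_swapVal_of_interval (hv : IsConsistentAntilinearization v)
    (hlam : StrictAnti lam) (hxy : IsAdmissible v lam x y) {a b : Orbit lam}
    (hD : ∀ z : Orbit lam, a ≤ z → z ≤ b → IsDominant v z.val)
    (haD : IsDominant v (a.swapVal x y).val) (ha : a < a.swapVal x y) (z : Orbit lam) :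
    a ≤ z → z ≤ b → z < z.swapVal x y → IsDominant v (z.swapVal x y).val := by
  have hadj := hxy.toIsAdjacent
  have hlt := hxy.lt
  induction z using WellFoundedLT.induction with
  | ind z ih =>
  intro haz hzb hz
  rcases haz.eq_or_lt with rfl | haz
  · exact haD
  have hzD := hD z haz.le hzb
  by_contra hn
  obtain ⟨s, t, hts, hs, ht⟩ := exists_lt_of_not_isDominant hlam hxy hzD hn
  have hst := hv.strictAnti hts
  obtain ⟨c, k, l, hac, hkl, hckl, rfl⟩ := exists_step_of_lt haz
  have hcz := c.lt_swapPos hkl hckl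
  have hcD := hD c hac (hcz.le.trans hzb)
  -- The pairs of positions of the two values in `c` and in `z` differ by the swap of `k` and `l`.
  have hpos : ∀ w, c.pos w = Equiv.swap k l ((c.swapPos k l).pos w) := fun w =>
    pos_eq hlam (by rw [← (c.swapPos k l).val_pos w]; rfl)
  have hx := hpos x
  have hy := hpos y
  have hcx := c.val_pos x
  have hcy := c.val_pos y
  rw [← hs] at hx
  rw [← ht] at hy
  rcases lt_swapVal_or_swapVal_lt hlam hadj c with hc | hc
  · have hscD := ih c hcz hac (hcz.le.trans hzb) hc
    have hc' := pos_lt_of_lt_swapVal hlam hadj hc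
    -- The positions in `c` cannot be labelled by comparable elements.
    have hncomp : ∀ s' t', v s' = c.pos x → v t' = c.pos y → ¬ t' < s' := by
      intro s' t' hs' ht' hlt'
      have := hscD.monotone s' t' hlt'
      rw [hs', ht', swapVal_val_pos_left, swapVal_val_pos_right] at this
      omega
    -- A step that moves one of the two values to such positions exchanges it with an entry that
    -- violates a dominance inequality of `c` or `z`, or else contradicts consistency of `v`.
    by_cases hsk : v s = k
    · rw [hsk, Equiv.swap_apply_left] at hx
      by_cases htl : v t = l
      · rw [htl, Equiv.swap_apply_right] at hy
        rw [hx, hy] at hc'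
        exact lt_asymm hc' hkl
      · rw [Equiv.swap_apply_of_ne_of_ne (by rintro h; exact hst.ne (hsk.trans h.symm)) htl] at hy
        rw [hx] at hcx
        obtain ⟨s', hs'⟩ := mem_range_of_pos hcD (l := l) (by omega)
        refine hncomp s' t (hs'.trans hx.symm) hy.symm (hv.consistent s s' t ?_ ?_ hts)
        · rw [hsk, hs']
          exact hkl
        · rwa [hs', ← hx, ← hy]
    by_cases hsl : v s = l
    · rw [hsl, Equiv.swap_apply_right] at hx
      rw [Equiv.swap_apply_of_ne_of_ne (by omega) (by omega)] at hy
      rw [hx] at hcx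
      rw [hy] at hcy
      have h1 := hcD.monotone s t hts
      rw [hsl, hcy] at h1
      rcases hadj.val_le_or_le c l with h | h
      · have := c.val_injective hlam (hcy.trans (le_antisymm h1 h))
        omega
      · omega
    rw [Equiv.swap_apply_of_ne_of_ne hsk hsl] at hx
    rw [hx] at hcx
    by_cases htk : v t = k
    · rw [htk, Equiv.swap_apply_left] at hy
      rw [hy] at hcy
      have h1 := hcD.monotone s t hts
      rw [htk, hcx] at h1
      rcases hadj.val_le_or_le c k with h | h
      · omega
      · exact hsk (c.val_injective hlam (hcx.trans (le_antisymm h h1)))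
    by_cases htl : v t = l
    · rw [htl, Equiv.swap_apply_right] at hy
      rw [hy] at hcy
      obtain ⟨s', hs'⟩ := mem_range_of_pos hcD (l := k) (by omega)
      have hlt' : t < s' := by
        refine hv.consistent s s' t ?_ ?_ hts
        · rwa [hs', ← hx, ← hy]
        · rw [htl, hs']
          exact hkl
      have h1 := hzD.monotone s' t hlt'
      rw [hs', htl] at h1
      simp at h1
      omega
    · rw [Equiv.swap_apply_of_ne_of_ne htk htl] at hy
      exact hncomp s t hx.symm hy.symm hts
  · -- The interchange descends at `c`. Then `c.swapVal x y` lies in the interval, and so does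
    -- a third composition between it and `z`, which is not dominant.
    have hc' := pos_lt_of_swapVal_lt hlam hadj hc
    have hasc := le_swapVal_of_le hlam hadj hac ha hc
    by_cases hsk : v s = k
    · rw [hsk, Equiv.swap_apply_left] at hx
      by_cases htl : v t = l
      · rw [hx] at hcx
        rw [htl, Equiv.swap_apply_right] at hy
        rw [hy] at hcy
        omega
      · have htk : v t ≠ k := by omega
        rw [Equiv.swap_apply_of_ne_of_ne htk htl] at hy
        rw [hx] at hcx
        rw [hy] at hcy
        -- At the positions `k < j < l` the entries of `c` are `c k, lam y, lam x`, those of `z` are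
        -- `lam x, lam y, c k`, and the third composition `f` has `lam x, c k, lam y`.
        set j := v t with hj
        set f := (c.swapVal x y).swapPos k j with hf
        have hscl : (c.swapVal x y).val k = c.val k :=
          swapVal_val_of_ne c (by omega) (by omega)
        have hscj : (c.swapVal x y).val j = lam x := by
          rw [← hy, swapVal_val_pos_right]
        have hscx : (c.swapVal x y).val l = lam y := by
          rw [← hx, swapVal_val_pos_left]
        have hjl : j < l := by rwa [hx, hy] at hc'
        have hkj : k < j := by omega
        have h1 : c.swapVal x y < f := lt_swapPos _ hkj (by omega)
        have hfk : f.val k = lam x := by simp [hf, hscj]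
        have hfj : f.val j = c.val k := by simp [hf, hscl]
        have hfl : f.val l = lam y := by
          simp [hf, Equiv.swap_apply_of_ne_of_ne hkl.ne' hjl.ne', hscx]
        have h2 : f < f.swapPos j l := lt_swapPos _ hjl (by omega)
        have h3 : f.swapPos j l = c.swapPos k l := by
          refine Orbit.ext (funext fun i => ?_)
          simp only [hf, swapPos_val, swapVal_val, hx, hy, Function.comp_apply]
          congr 1
          simp only [Equiv.swap_apply_def]
          split_ifs <;> omega
        rw [h3] at h2
        have hfD := hD f (hasc.trans h1.le) (h2.le.trans hzb)
        have := hfD.monotone s t hts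
        rw [← hj, hsk, hfj, hfk] at this
        omega
    by_cases hsl : v s = l
    · rw [hsl, Equiv.swap_apply_right] at hx
      rw [Equiv.swap_apply_of_ne_of_ne (by omega) (by omega)] at hy
      omega
    rw [Equiv.swap_apply_of_ne_of_ne hsk hsl] at hx
    by_cases htk : v t = k
    · rw [htk, Equiv.swap_apply_left] at hy
      omega
    by_cases htl : v t = l
    · rw [htl, Equiv.swap_apply_right] at hy
      rw [hx] at hcx
      rw [hy] at hcy
      -- At the positions `k < i < l` the entries of `c` are `lam y, lam x, c l`, those of `z` are
      -- `c l, lam x, lam y`, and the third composition `f` has `lam x, c l, lam y`.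
      set i := v s with hi
      set f := (c.swapVal x y).swapPos i l with hf
      have hki : k < i := by rwa [hx, hy] at hc'
      have hil : i < l := by omega
      have hsck : (c.swapVal x y).val k = lam x := by
        rw [← hy, swapVal_val_pos_right]
      have hsci : (c.swapVal x y).val i = lam y := by
        rw [← hx, swapVal_val_pos_left]
      have hscl : (c.swapVal x y).val l = c.val l :=
        swapVal_val_of_ne c (by omega) (by omega)
      have h1 : c.swapVal x y < f := lt_swapPos _ hil (by omega)
      have hfk : f.val k = lam x := by
        simp [hf, Equiv.swap_apply_of_ne_of_ne hki.ne hkl.ne, hsck]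
      have hfi : f.val i = c.val l := by simp [hf, hscl]
      have hfl : f.val l = lam y := by simp [hf, hsci]
      have h2 : f < f.swapPos k i := lt_swapPos _ hki (by omega)
      have h3 : f.swapPos k i = c.swapPos k l := by
        refine Orbit.ext (funext fun j => ?_)
        simp only [hf, swapPos_val, swapVal_val, hx, hy, Function.comp_apply]
        congr 1
        simp only [Equiv.swap_apply_def]
        split_ifs <;> omega
      rw [h3] at h2
      have hfD := hD f (hasc.trans h1.le) (h2.le.trans hzb)
      have := hfD.monotone s t hts
      rw [← hi, htl, hfi, hfl] at this
      omega
    · rw [Equiv.swap_apply_of_ne_of_ne htk htl] at hy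
      rw [hx, hy] at hc'
      exact lt_asymm hc' hst

/-- If an interchange ascends at `a` and at `d ≥ a`, and leaves the set of dominant compositions
at `d` but not at `a`, then `d` already lies above the interchanged `a`. -/
theorem swapVal_le_of_not_isDominant (hv : IsConsistentAntilinearization v)
    (hlam : StrictAnti lam) (hxy : IsAdmissible v lam x y) {a d : Orbit lam}
    (haD : IsDominant v a.val) (hsaD : IsDominant v (a.swapVal x y).val)
    (hdD : IsDominant v d.val) (hsdD : ¬ IsDominant v (d.swapVal x y).val)
    (had : a ≤ d) (ha : a < a.swapVal x y) : a.swapVal x y ≤ d := by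
  classical
  have hadj := hxy.toIsAdjacent
  have hlt := hxy.lt
  obtain ⟨s, t, hts, hs, ht⟩ := exists_lt_of_not_isDominant hlam hxy hdD hsdD
  have hst := hv.strictAnti hts
  have hij := pos_lt_of_lt_swapVal hlam hadj ha
  rw [le_iff_prefixCount hlam] at had ⊢
  intro p q
  have hcount := prefixCount_swapVal hadj hij p q
  have hpq := had p q
  split_ifs at hcount with hc
  swap
  · omega
  obtain ⟨hip, hpj, hq, hq'⟩ := hc
  -- Otherwise the counts at `(p, q)` agree, and `p` separates the two positions in `d` as well.
  by_contra hcon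
  have heq : prefixCount d.val p q = prefixCount a.val p q := by omega
  have al := prefixCount_lower hlam hadj a p hq hq'
  have au := prefixCount_upper hlam hadj a p hq hq'
  have dl := prefixCount_lower hlam hadj d p hq hq'
  have du := prefixCount_upper hlam hadj d p hq hq'
  have hl := had p (lam y)
  have hu := had p (lam x + 1)
  rw [if_neg (by omega)] at al
  rw [if_pos hip] at au
  have hsp : (v s : ℕ) < p := by
    rw [← hs] at du
    by_contra h
    rw [if_neg h] at du
    omega
  have hpt : p ≤ (v t : ℕ) := by
    rw [← ht] at dl
    by_contra h
    rw [if_pos (by omega)] at dl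
    omega
  have hdt : d.val (v t) = lam y := by rw [ht, val_pos]
  -- Comparing counts between `p` and `v t` shows that `a` is at least `lam y` at `v t`.
  have hat : lam y ≤ a.val (v t) := by
    have h1 := had (v t + 1) (lam y)
    rw [prefixCount_eq_add_of_le d.val _ (show p ≤ v t + 1 by omega),
      prefixCount_eq_add_of_le a.val _ (show p ≤ v t + 1 by omega)] at h1
    rw [if_neg (by rw [← ht]; omega)] at dl
    have hsub : (Finset.univ.filter
          fun i : Fin m => p ≤ (i : ℕ) ∧ (i : ℕ) < v t + 1 ∧ lam y ≤ a.val i)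
        ⊆ Finset.univ.filter
          fun i : Fin m => p ≤ (i : ℕ) ∧ (i : ℕ) < v t + 1 ∧ lam y ≤ d.val i := by
      intro i
      simp only [Finset.mem_filter, Finset.mem_univ, true_and]
      rintro ⟨h2, h3, h4⟩
      refine ⟨h2, h3, ?_⟩
      obtain ⟨r, rfl⟩ := hxy.mem_range haD h4
      rcases (Nat.lt_succ_iff.1 h3).eq_or_lt with h5 | h5
      · rw [Fin.ext h5, hdt]
      · rw [← hdt]
        exact hdD.monotone r t (hv.consistent s r t (Fin.lt_def.2 (by omega)) h5 hts)
    have hset := Finset.eq_of_subset_of_card_le hsub (by omega)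
    have hmem : v t ∈ Finset.univ.filter
        fun i : Fin m => p ≤ (i : ℕ) ∧ (i : ℕ) < v t + 1 ∧ lam y ≤ d.val i := by
      simp [hpt, hdt]
    rw [← hset] at hmem
    exact (Finset.mem_filter.1 hmem).2.2.2
  -- The larger value of `a` sits at a position labelled by an element above `t`.
  have hi : ∃ r, v r = a.pos x ∧ t < r := by
    obtain ⟨r₀, hr₀⟩ := hxy.mem_range haD (l := a.pos x) (by rw [val_pos]; exact hlt.le)
    obtain ⟨P, ⟨r, rfl, htr⟩, hPmin⟩ := (wellFounded_lt (α := Fin m)).has_min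
      {k | ∃ r, v r = k ∧ t < r} ⟨v s, s, rfl, hts⟩
    have hrs : v r ≤ v s := not_lt.1 (hPmin (v s) ⟨s, rfl, hts⟩)
    rcases lt_trichotomy (v r) (a.pos x) with h | h | h
    · refine ⟨r₀, hr₀, hv.consistent r r₀ t (by rwa [hr₀]) ?_ htr⟩
      rw [hr₀, Fin.lt_def]
      omega
    · exact ⟨r, h, htr⟩
    · exfalso
      rw [Fin.le_def] at hrs
      have hrp : (v r : ℕ) ≤ p := by omega
      -- Between `v r` and `p` both compositions are large exactly on the image of `v`.
      have key : ∀ c : Orbit lam, IsDominant v c.val → lam y ≤ c.val (v t) → p ≤ (c.pos y : ℕ) →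
          (Finset.univ.filter fun i : Fin m => (v r : ℕ) ≤ (i : ℕ) ∧ (i : ℕ) < p ∧ q ≤ c.val i)
            = Finset.univ.filter
              fun i : Fin m => (v r : ℕ) ≤ (i : ℕ) ∧ (i : ℕ) < p ∧ ∃ r', v r' = i := by
        intro c hcD hct hpc
        refine Finset.filter_congr fun i _ => and_congr_right fun h2 => and_congr_right fun h3 => ?_
        constructor
        · intro h4
          exact hxy.mem_range hcD (hq.le.trans h4)
        · rintro ⟨r', rfl⟩
          have htr' : t < r' := by
            rcases h2.eq_or_lt with h5 | h5
            · rwa [← hv.injective (Fin.ext h5)]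
            · exact hv.consistent r r' t h5 (Fin.lt_def.2 (by omega)) htr
          have h6 := hcD.monotone r' t htr'
          rcases hadj.val_le_or_le c (v r') with h7 | h7
          · have := pos_eq hlam (le_antisymm h7 (hct.trans h6))
            rw [this] at hpc
            omega
          · exact hq'.trans h7
      have h1 := prefixCount_eq_add_of_le a.val q hrp
      have h2 := prefixCount_eq_add_of_le d.val q hrp
      rw [key a haD hat hpj] at h1
      rw [key d hdD hdt.ge (by rwa [← ht])] at h2
      have h3 := prefixCount_upper hlam hadj a (v r) hq hq'
      have h4 := prefixCount_upper hlam hadj d (v r) hq hq'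
      rw [if_pos (Fin.lt_def.1 h)] at h3
      rw [← hs, if_neg (by omega)] at h4
      have h5 := had (v r) (lam x + 1)
      omega
  -- Hence the interchange at `a` also leaves the dominant compositions.
  obtain ⟨r, hr, htr⟩ := hi
  have h1 := hsaD.monotone r t htr
  rw [hr, swapVal_val_pos_left] at h1
  by_cases hjt : v t = a.pos y
  · rw [hjt, swapVal_val_pos_right] at h1
    omega
  · rw [swapVal_val_of_ne a (by omega) hjt] at h1
    exact hjt (pos_eq hlam (le_antisymm h1 hat)).symm

/-! ### Existence of descents -/

/-- The zero entries outside the image of `v` are common to a whole interval: all entries before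
such a position are positive, which the prefix counts detect. -/
theorem val_eq_zero_of_mem_interval (hlam : StrictAnti lam) {a b c : Orbit lam} (hac : a ≤ c)
    (hcb : c ≤ b) {l : Fin m} (ha : a.val l = 0) (hb : b.val l = 0) : c.val l = 0 := by
  have hfull : ∀ d : Orbit lam, d.val l = 0 → prefixCount d.val l 1 = prefixCount d.val l 0 := by
    intro d hd
    unfold prefixCount
    congr 1
    refine Finset.filter_congr fun i _ => and_congr_right fun hi => ?_
    simp only [Nat.zero_le, iff_true]
    by_contra h
    have := d.val_injective hlam (show d.val i = d.val l by omega)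
    omega
  have hzero : ∀ d : Orbit lam, prefixCount d.val l 0 = prefixCount a.val l 0 := by
    intro d
    unfold prefixCount
    simp
  have h1 := (le_iff_prefixCount hlam).1 hac (l + 1) 1
  have h2 := (le_iff_prefixCount hlam).1 hcb l 1
  rw [prefixCount_succ, prefixCount_succ, hfull a ha, ha] at h1
  rw [hfull b hb, hzero] at h2
  split_ifs at h1 <;> omega

/-- A dominant composition that is not minimal among dominant compositions has an admissible
descent. -/
theorem exists_isAdmissible_swapVal_lt (hlam : StrictAnti lam) {a b : Orbit lam}
    (ha : IsDominant v a.val) (hb : IsDominant v b.val) (hab : a < b) :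
    ∃ x y, IsAdmissible v lam x y ∧ b.swapVal x y < b := by
  obtain ⟨c, k, l, hac, hkl, hc, rfl⟩ := exists_step_of_lt hab
  set b := c.swapPos k l with hbdef
  have hcb : c < b := c.lt_swapPos hkl hc
  have hbk : b.val k = c.val l := by simp [hbdef]
  have hbl : b.val l = c.val k := by simp [hbdef]
  have hk : k ∈ Set.range v := by
    by_contra hcon
    have h1 := hb.eq_zero k hcon
    have h2 := val_eq_zero_of_mem_interval hlam hac hcb.le (ha.eq_zero k hcon) h1
    omega
  have hgap : ∀ j, j ∉ Set.range v → 0 < b.val k := by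
    intro j hj
    refine Nat.pos_of_ne_zero fun h0 => ?_
    have := b.val_injective hlam (h0.trans (hb.eq_zero j hj).symm)
    exact hj (this ▸ hk)
  -- Among the pairs of values out of order choose one whose difference is least.
  obtain ⟨x₀, hx₀⟩ := b.exists_eq_lam l
  obtain ⟨y₀, hy₀⟩ := b.exists_eq_lam k
  have hne : {w : Fin m × Fin m | b.pos w.2 < b.pos w.1 ∧ lam w.2 < lam w.1
      ∧ b.val k ≤ lam w.2}.Nonempty := by
    refine ⟨(x₀, y₀), ?_, ?_, hy₀.le⟩
    · rw [pos_eq hlam hx₀, pos_eq hlam hy₀]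
      exact hkl
    · change lam y₀ < lam x₀
      omega
  obtain ⟨⟨x, y⟩, ⟨h1, h2, h3⟩, hmin⟩ :=
    (measure fun w : Fin m × Fin m => lam w.1 - lam w.2).wf.has_min _ hne
  dsimp only at h1 h2 h3
  have hadj : IsAdjacent lam x y := by
    refine ⟨h2, fun z => ?_⟩
    by_contra! hz
    obtain ⟨hz1, hz2⟩ := hz
    rcases lt_or_ge (b.pos z) (b.pos x) with h | h
    · refine hmin (x, z) ⟨h, hz2, h3.trans hz1.le⟩ ?_
      change lam x - lam z < lam x - lam y
      omega
    · refine hmin (z, y) ⟨h1.trans_le h, hz1, h3⟩ ?_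
      change lam z - lam y < lam x - lam y
      omega
  exact ⟨x, y, ⟨hadj, fun j hj => (hgap j hj).trans_le h3⟩, swapVal_lt hlam hadj h1⟩

end Orbit

/-! ### Rank and Möbius function of a finite poset -/

section FinitePoset
variable {X : Type*} [PartialOrder X] [Finite X]

theorem coe_rk (x : X) : (rk x : ℕ∞) = Order.height x := by
  have := Fintype.ofFinite X
  refine ENat.natCast_toNat fun h => ?_
  obtain ⟨p, -, hp⟩ := Order.height_eq_top_iff.1 h (Fintype.card X)
  exact p.length_lt_card.ne hp

theorem rk_strictMono : StrictMono (rk : X → ℕ) := by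
  intro x y hxy
  have := Order.height_add_one_le hxy
  rw [← coe_rk, ← coe_rk] at this
  exact_mod_cast this

theorem rk_le_of_forall_lt {x : X} {n : ℕ} (h : ∀ y < x, rk y < n) : rk x ≤ n := by
  have : Order.height x ≤ n := Order.height_le_coe_iff.2 fun y hy => by
    rw [← coe_rk]
    exact_mod_cast h y hy
  rw [← coe_rk] at this
  exact_mod_cast this

theorem mobius_of_not_le {x y : X} (h : ¬ x ≤ y) : mobius x y = 0 := by
  unfold mobius
  exact IncidenceAlgebra.apply_eq_zero_of_not_le h _

/-- The Möbius function is characterized by the vanishing of its sums over the first argument. -/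
theorem mobius_eq_of_sum_eq_zero (y : X) (f : X → ℤ) (hy : f y = 1)
    (h : ∀ x < y, ∑ c ∈ (Set.toFinite (Set.Icc x y)).toFinset, f c = 0) (x : X) (hxy : x ≤ y) :
    mobius x y = f x := by
  classical
  let : Fintype X := Fintype.ofFinite X
  let : LocallyFiniteOrder X := Fintype.toLocallyFiniteOrder
  induction x using WellFoundedGT.induction with
  | ind x ih =>
  rcases hxy.eq_or_lt with rfl | hlt
  · rw [hy]
    unfold mobius
    convert IncidenceAlgebra.mu_self (𝕜 := ℤ) x
  · have h1 : mobius x y = -∑ c ∈ Finset.Ioc x y, mobius c y := by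
      unfold mobius
      convert IncidenceAlgebra.mu_eq_neg_sum_Ioc_of_ne (𝕜 := ℤ) hlt.ne
    have h2 : (Set.toFinite (Set.Icc x y)).toFinset = insert x (Finset.Ioc x y) := by
      ext c
      simp only [Set.Finite.mem_toFinset, Set.mem_Icc, Finset.mem_insert, Finset.mem_Ioc]
      constructor
      · rintro ⟨h3, h4⟩
        exact h3.eq_or_lt.imp Eq.symm fun h5 => ⟨h5, h4⟩
      · rintro (rfl | ⟨h3, h4⟩)
        · exact ⟨le_rfl, hxy⟩
        · exact ⟨h3.le, h4⟩
    have h3 := h x hlt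
    rw [h2, Finset.sum_insert (by simp)] at h3
    rw [h1, Finset.sum_congr rfl fun c hc => ih c (Finset.mem_Ioc.1 hc).1 (Finset.mem_Ioc.1 hc).2]
    exact neg_eq_of_add_eq_zero_left h3

end FinitePoset

namespace Orbit
variable {m : ℕ} {lam : Fin m → ℕ} {S : Type*} [PartialOrder S] {v : S → Fin m} {x y : Fin m}

/-! ### The alternating sum -/

/-- A descending interchange of admissible values lowers the rank among dominant compositions by
exactly one: by the lifting property, every dominant `c < d` either lies below the interchanged `d`
or is sent strictly below it. -/
theorem rk_eq_rk_swapVal_add_one (hv : IsConsistentAntilinearization v) (hlam : StrictAnti lam)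
    (hxy : IsAdmissible v lam x y) {d e : DominantPoset v lam} (he : e.val = d.val.swapVal x y)
    (h : e < d) : rk d = rk e + 1 := by
  have hadj := hxy.toIsAdjacent
  induction d using WellFoundedLT.induction generalizing e with
  | ind d ih =>
  have hd : d.val.swapVal x y < d.val := he ▸ h
  refine le_antisymm (rk_le_of_forall_lt fun c hc => Nat.lt_succ_iff.2 ?_) (rk_strictMono h)
  rcases lt_swapVal_or_swapVal_lt hlam hadj c.val with h1 | h1
  · refine rk_strictMono.monotone ?_
    change c.val ≤ e.val
    rw [he]
    exact le_swapVal_of_le hlam hadj hc.le h1 hd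
  · let c' : DominantPoset v lam :=
      ⟨c.val.swapVal x y, isDominant_swapVal_of_lt hv hlam hxy c.2 h1⟩
    rw [ih c hc (e := c') rfl h1]
    refine rk_strictMono (lt_of_le_of_ne ?_ fun h2 => hc.ne (Subtype.ext ?_))
    · change c.val.swapVal x y ≤ e.val
      rw [he]
      exact swapVal_mono_of_swapVal_lt hlam hadj hc.le h1 hd
    · have h3 : c.val.swapVal x y = d.val.swapVal x y := by
        rw [← he, ← h2]
      rw [← swapVal_swapVal hlam c.val x y, h3, swapVal_swapVal hlam]

open Classical in
/-- The sign of a dominant composition given by its rank among the dominant compositions, extended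
by zero to the whole orbit. -/
noncomputable def rankSign (v : S → Fin m) (d : Orbit lam) : ℤ :=
  if h : IsDominant v d.val then (-1) ^ rk (⟨d, h⟩ : DominantPoset v lam) else 0

theorem rankSign_val (d : DominantPoset v lam) : rankSign v d.val = (-1) ^ rk d :=
  dif_pos d.2

theorem rankSign_add_rankSign_swapVal (hv : IsConsistentAntilinearization v)
    (hlam : StrictAnti lam) (hxy : IsAdmissible v lam x y) {d : Orbit lam}
    (hd : IsDominant v d.val) (hsd : IsDominant v (d.swapVal x y).val) :
    rankSign v d + rankSign v (d.swapVal x y) = 0 := by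
  let d₁ : DominantPoset v lam := ⟨d, hd⟩
  let d₂ : DominantPoset v lam := ⟨d.swapVal x y, hsd⟩
  change rankSign v d₁.val + rankSign v d₂.val = 0
  rw [rankSign_val, rankSign_val]
  rcases lt_swapVal_or_swapVal_lt hlam hxy.toIsAdjacent d with h | h
  · rw [rk_eq_rk_swapVal_add_one hv hlam hxy (d := d₂) (e := d₁)
      (swapVal_swapVal hlam d x y).symm h]
    ring
  · rw [rk_eq_rk_swapVal_add_one hv hlam hxy (d := d₁) (e := d₂) rfl h]
    ring

/-- The compositions `c` between `a` and `b` for which the whole interval from `c` to `b` consists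
of dominant compositions. -/
noncomputable def fullBelow (v : S → Fin m) (a b : Orbit lam) : Finset (Orbit lam) :=
  (Set.toFinite {c : Orbit lam | a ≤ c ∧ c ≤ b ∧ ∀ z : Orbit lam, c ≤ z → z ≤ b →
    IsDominant v z.val}).toFinset

theorem mem_fullBelow {a b c : Orbit lam} : c ∈ fullBelow v a b ↔
    a ≤ c ∧ c ≤ b ∧ ∀ z : Orbit lam, c ≤ z → z ≤ b → IsDominant v z.val := by
  simp [fullBelow]

/-- If an admissible interchange descends at `b` and ascends at `a`, it is a sign-reversing
involution on the summands. -/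
theorem sum_rankSign_eq_zero_of_lt_swapVal (hv : IsConsistentAntilinearization v)
    (hlam : StrictAnti lam) (hxy : IsAdmissible v lam x y) {a b : Orbit lam}
    (ha : a < a.swapVal x y) (hb : b.swapVal x y < b) :
    ∑ c ∈ fullBelow v a b, rankSign v c = 0 := by
  have hadj := hxy.toIsAdjacent
  have hmem : ∀ c ∈ fullBelow v a b, c.swapVal x y ∈ fullBelow v a b := by
    intro c hc
    rw [mem_fullBelow] at hc ⊢
    obtain ⟨hac, hcb, hfull⟩ := hc
    rcases lt_swapVal_or_swapVal_lt hlam hadj c with h | h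
    · exact ⟨hac.trans h.le, swapVal_le_of_le hlam hadj hcb h hb,
        fun z hz => hfull z (h.le.trans hz)⟩
    · refine ⟨le_swapVal_of_le hlam hadj hac ha h, h.le.trans hcb, fun z hz hzb => ?_⟩
      have hc' : c.swapVal x y < (c.swapVal x y).swapVal x y := by rwa [swapVal_swapVal hlam]
      rcases lt_swapVal_or_swapVal_lt hlam hadj z with h1 | h1
      · have h2 : c ≤ z.swapVal x y := by
          have := swapVal_le_of_le hlam hadj (hz.trans h1.le) hc' (by rwa [swapVal_swapVal hlam])
          rwa [swapVal_swapVal hlam] at this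
        have h3 := hfull _ h2 (swapVal_le_of_le hlam hadj hzb h1 hb)
        have h4 := isDominant_swapVal_of_lt hv hlam hxy h3 (by rwa [swapVal_swapVal hlam])
        rwa [swapVal_swapVal hlam] at h4
      · have h2 := swapVal_le_of_le hlam hadj hz hc' h1
        rw [swapVal_swapVal hlam] at h2
        exact hfull z h2 hzb
  have hdom : ∀ c ∈ fullBelow v a b, IsDominant v c.val := by
    intro c hc
    rw [mem_fullBelow] at hc
    exact hc.2.2 c le_rfl hc.2.1
  refine Finset.sum_involution (fun c _ => c.swapVal x y) (fun c hc => ?_) (fun c _ _ => ?_) hmem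
    fun c _ => swapVal_swapVal hlam c x y
  · exact rankSign_add_rankSign_swapVal hv hlam hxy (hdom c hc) (hdom _ (hmem c hc))
  · rcases lt_swapVal_or_swapVal_lt hlam hadj c with h | h
    · exact h.ne'
    · exact h.ne

/-- If an admissible interchange descends at both `a` and `b`, then outside the elements above `a`
it does not matter whether the summands are taken below `b` or below the interchanged `b`. -/
theorem mem_fullBelow_swapVal_iff (hv : IsConsistentAntilinearization v)
    (hlam : StrictAnti lam) (hxy : IsAdmissible v lam x y) {a b c : Orbit lam}
    (haD : IsDominant v a.val) (ha : a.swapVal x y < a)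
    (hb : b.swapVal x y < b) (hac : ¬ a ≤ c) :
    c ∈ fullBelow v (a.swapVal x y) (b.swapVal x y) ↔ c ∈ fullBelow v (a.swapVal x y) b := by
  have hadj := hxy.toIsAdjacent
  have ha' : a.swapVal x y < (a.swapVal x y).swapVal x y := by rwa [swapVal_swapVal hlam]
  rw [mem_fullBelow, mem_fullBelow]
  refine and_congr_right fun hc => ?_
  have hasc : c < c.swapVal x y := by
    rcases lt_swapVal_or_swapVal_lt hlam hadj c with h | h
    · exact h
    · have := swapVal_le_of_le hlam hadj hc ha' h
      rw [swapVal_swapVal hlam] at this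
      exact absurd this hac
  constructor
  · rintro ⟨hcb, hfull⟩
    refine ⟨hcb.trans hb.le, fun z hcz hzb => ?_⟩
    have hscD : IsDominant v (c.swapVal x y).val := by
      by_contra hn
      refine hac ?_
      have := swapVal_le_of_not_isDominant hv hlam hxy
        (isDominant_swapVal_of_lt hv hlam hxy haD ha) (by rwa [swapVal_swapVal hlam])
        (hfull c le_rfl hcb) hn hc ha'
      rwa [swapVal_swapVal hlam] at this
    rcases lt_swapVal_or_swapVal_lt hlam hadj z with h | h
    · exact hfull z hcz (le_swapVal_of_le hlam hadj hzb h hb)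
    · have := isDominant_swapVal_of_interval hv hlam hxy hfull hscD hasc (z.swapVal x y)
        (le_swapVal_of_le hlam hadj hcz hasc h) (swapVal_mono_of_swapVal_lt hlam hadj hzb h hb)
        (by rwa [swapVal_swapVal hlam])
      rwa [swapVal_swapVal hlam] at this
  · rintro ⟨hcb, hfull⟩
    exact ⟨le_swapVal_of_le hlam hadj hcb hasc hb, fun z hcz hzb => hfull z hcz (hzb.trans hb.le)⟩

/-- For dominant `a < b` the alternating sum over the `c ≥ a` with `[c, b]` full vanishes. -/
theorem sum_rankSign_eq_zero (hv : IsConsistentAntilinearization v) (hlam : StrictAnti lam)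
    (b : Orbit lam) : ∀ a : Orbit lam, IsDominant v a.val → IsDominant v b.val → a < b →
      ∑ c ∈ fullBelow v a b, rankSign v c = 0 := by
  classical
  induction b using WellFoundedLT.induction with
  | ind b ih =>
  intro a haD hbD hab
  obtain ⟨x, y, hxy, hb⟩ := exists_isAdmissible_swapVal_lt hlam haD hbD hab
  have hadj := hxy.toIsAdjacent
  rcases lt_swapVal_or_swapVal_lt hlam hadj a with ha | ha
  · exact sum_rankSign_eq_zero_of_lt_swapVal hv hlam hxy ha hb
  have hsaD := isDominant_swapVal_of_lt hv hlam hxy haD ha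
  have hsbD := isDominant_swapVal_of_lt hv hlam hxy hbD hb
  have ha' : a.swapVal x y < (a.swapVal x y).swapVal x y := by rwa [swapVal_swapVal hlam]
  have hne : ∀ {d : Orbit lam}, d.swapVal x y < d → d ≠ b.swapVal x y := by
    rintro d hd rfl
    rw [swapVal_swapVal hlam] at hd
    exact lt_asymm hd hb
  have hfilter : ∀ b' : Orbit lam,
      (fullBelow v (a.swapVal x y) b').filter (a ≤ ·) = fullBelow v a b' := by
    intro b'
    ext c
    simp only [Finset.mem_filter, mem_fullBelow]
    exact ⟨fun h => ⟨h.2, h.1.2⟩, fun h => ⟨⟨ha.le.trans h.1, h.2⟩, h.1⟩⟩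
  have hnot : (fullBelow v (a.swapVal x y) (b.swapVal x y)).filter (¬ a ≤ ·)
      = (fullBelow v (a.swapVal x y) b).filter (¬ a ≤ ·) := by
    ext c
    simp only [Finset.mem_filter]
    exact and_congr_left fun h => mem_fullBelow_swapVal_iff hv hlam hxy haD ha hb h
  -- With `s` the interchange: the sum over `[s a, b]` is that over `[a, b]` plus the part not above
  -- `a`, and the latter is also what `[s a, s b]` has in excess of `[a, s b]`.
  have h1 := Finset.sum_filter_add_sum_filter_not (fullBelow v (a.swapVal x y) b) (a ≤ ·)
    (rankSign v)
  have h2 := Finset.sum_filter_add_sum_filter_not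
    (fullBelow v (a.swapVal x y) (b.swapVal x y)) (a ≤ ·) (rankSign v)
  rw [hfilter, sum_rankSign_eq_zero_of_lt_swapVal hv hlam hxy ha' hb] at h1
  have hlt : a.swapVal x y < b.swapVal x y := by
    refine lt_of_le_of_ne (swapVal_mono_of_swapVal_lt hlam hadj hab.le ha hb) fun h => hab.ne ?_
    rw [← swapVal_swapVal hlam a x y, h, swapVal_swapVal hlam]
  rw [hfilter, hnot, ih _ hb _ hsaD hsbD hlt] at h2
  have h3 : ∑ c ∈ fullBelow v a (b.swapVal x y), rankSign v c = 0 := by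
    by_cases h : a ≤ b.swapVal x y
    · exact ih _ hb a haD hsbD (lt_of_le_of_ne h (hne ha))
    · refine Finset.sum_eq_zero fun c hc => ?_
      rw [mem_fullBelow] at hc
      exact absurd (hc.1.trans hc.2.1) h
  omega

end Orbit
end BruhatDominant

open Classical in
theorem corollary2p14 {m : ℕ} {S : Type*} [PartialOrder S] (v : S → Fin m)
    (hv : BruhatDominant.IsConsistentAntilinearization v)
    (lam : Fin m → ℕ) (hlam : StrictAnti lam)
    (a b : BruhatDominant.DominantPoset v lam) :
    BruhatDominant.mobius a b =
      if a ≤ b ∧ ∀ c : BruhatDominant.Orbit lam,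
          a.val < c → c < b.val → BruhatDominant.IsDominant v c.val then
        (-1 : ℤ) ^ (BruhatDominant.rk b - BruhatDominant.rk a)
      else 0 := by
  by_cases hab : a ≤ b
  swap
  · rw [if_neg fun h => hab h.1, BruhatDominant.mobius_of_not_le hab]
  refine BruhatDominant.mobius_eq_of_sum_eq_zero b (fun c : BruhatDominant.DominantPoset v lam =>
    if c ≤ b ∧ ∀ z : BruhatDominant.Orbit lam,
          c.val < z → z < b.val → BruhatDominant.IsDominant v z.val then
        (-1 : ℤ) ^ (BruhatDominant.rk b - BruhatDominant.rk c)
      else 0) ?_ ?_ a hab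
  · simp only [le_refl, Nat.sub_self, pow_zero, true_and]
    exact if_pos fun z h1 h2 => absurd (h1.trans h2) (lt_irrefl _)
  intro a hlt
  have hsum := BruhatDominant.Orbit.sum_rankSign_eq_zero hv hlam b.val a.val a.2 b.2 hlt
  rw [← Finset.sum_filter]
  calc _ = ∑ c ∈ BruhatDominant.Orbit.fullBelow v a.val b.val,
        (-1) ^ BruhatDominant.rk b * BruhatDominant.Orbit.rankSign v c := by
        refine Finset.sum_bij (fun c _ => c.val) (fun c hc => ?_)
          (fun c _ d _ h => Subtype.ext h) (fun c hc => ?_) fun c hc => ?_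
        · simp only [Finset.mem_filter, Set.Finite.mem_toFinset, Set.mem_Icc] at hc
          refine BruhatDominant.Orbit.mem_fullBelow.2 ⟨hc.1.1, hc.1.2, fun z hcz hzb => ?_⟩
          rcases hcz.eq_or_lt with rfl | hcz
          · exact c.2
          rcases hzb.eq_or_lt with rfl | hzb
          · exact b.2
          exact hc.2.2 z hcz hzb
        · obtain ⟨h1, h2, h3⟩ := BruhatDominant.Orbit.mem_fullBelow.1 hc
          refine ⟨⟨c, h3 c le_rfl h2⟩, ?_, rfl⟩
          simp only [Finset.mem_filter, Set.Finite.mem_toFinset, Set.mem_Icc]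
          exact ⟨⟨h1, h2⟩, h2, fun z hcz hzb => h3 z hcz.le hzb.le⟩
        · simp only [Finset.mem_filter] at hc
          obtain ⟨k, hk⟩ := Nat.exists_eq_add_of_le
            (BruhatDominant.rk_strictMono.monotone hc.2.1)
          rw [BruhatDominant.Orbit.rankSign_val, hk, Nat.add_sub_cancel_left, pow_add,
            mul_right_comm, ← mul_pow]
          simp
    _ = 0 := by rw [← Finset.mul_sum, hsum, mul_zero]
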